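/- Let $\alpha,\beta,\mu\in\mathbb{R}\setminus\{0\}$ with $\Delta:=\alpha^2+\beta^2-2\mu^2>0$, and let $x_1,x_2\in\mathbb{R}$. Put $\delta:=\alpha^2-3\beta^2$, $\gamma:=3\alpha^2-\beta^2$, $y_1:=x+\delta t+x_1$, $y_2:=x+\gamma t+x_2$ and \[ G_\mu(t,x):=\frac{\beta\sqrt{\alpha^2+\beta^2}}{\alpha\sqrt{\Delta}}\sin(\alpha y_1)-\frac{\sqrt2\,\mu\beta[\cosh(\beta y_2)+\sinh(\beta y_2)]}{\Delta}, \] \[ F_\mu(t,x):=\cosh(\beta y_2)-\frac{\sqrt2\,\mu\beta[\alpha\cos(\alpha y_1)-\beta\sin(\alpha y_1)]}{\alpha\sqrt{\alpha^2+\beta^2}\sqrt{\Delta}} . \] The Gardner breather is \[ B_\mu(t,x):=2\sqrt2\,\partial_x\Big[\arctan\Big(\frac{G_\mu}{F_\mu}\Big)\Big]=2\sqrt2\,\frac{F_\mu\,\partial_xG_\mu-G_\mu\,\partial_xF_\mu}{F_\mu^2+G_\mu^2}, \] where the last expression is taken as the definition also at the zeros of $F_\mu$. For a function $w=w(t,x)$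 put \[ F_\mu[w](t):=\frac12\int_{\mathbb R}w_{xx}^2\,dx-5\mu\int_{\mathbb R}w\,w_x^2\,dx+\frac52\mu^2\int_{\mathbb R}w^4\,dx-\frac52\int_{\mathbb R}w^2w_x^2\,dx+\frac32\mu\int_{\mathbb R}w^5\,dx+\frac14\int_{\mathbb R}w^6\,dx . \] Then, for every $t\in\mathbb{R}$, one has $F_\mu(t,x)^2+G_\mu(t,x)^2>0$ for all $x\in\mathbb{R}$, the function $B_\mu(t,\cdot)$ is smooth, the six integrals in $F_\mu[B_\mu](t)$ converge absolutely, and \[ F_\mu[B_\mu](t)=\frac{4}{15}\Big(3|\beta|(\beta^4-10\beta^2\alpha^2+5\alpha^4)-10\mu^2|\beta|(\beta^2-3\alpha^2-6\mu^2)\Big)+8\sqrt2\,\mu^5\arctan\Big[\frac{2\sqrt2\,\mu|\beta|}{\Delta}\Big]. \] In particular, for $\beta>0$ this is the same formula with $\beta$ in place of $|\beta|$. -/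

import Mathlib

noncomputable section

namespace Gardner

/-- `Δ = α² + β² - 2μ²`. -/
def Delta (α β μ : ℝ) : ℝ := α ^ 2 + β ^ 2 - 2 * μ ^ 2

/-- `δ = α² - 3β²`. -/
def delta (α β : ℝ) : ℝ := α ^ 2 - 3 * β ^ 2

/-- `γ = 3α² - β²`. -/
def gam (α β : ℝ) : ℝ := 3 * α ^ 2 - β ^ 2

/-- `y₁ = x + δ t + x₁`. -/
def y1 (α β x1 t x : ℝ) : ℝ := x + delta α β * t + x1

/-- `y₂ = x + γ t + x₂`. -/
def y2 (α β x2 t x : ℝ) : ℝ := x + gam α β * t + x2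

/-- The function `G_{α,β,μ}(t,x)` in the numerator of the breather phase. -/
def G (α β μ x1 x2 t x : ℝ) : ℝ :=
  β * √(α ^ 2 + β ^ 2) / (α * √(Delta α β μ)) * Real.sin (α * y1 α β x1 t x)
    - √2 * μ * β * (Real.cosh (β * y2 α β x2 t x) + Real.sinh (β * y2 α β x2 t x))
      / Delta α β μ

/-- The function `F_{α,β,μ}(t,x)` in the denominator of the breather phase. -/
def F (α β μ x1 x2 t x : ℝ) : ℝ :=
  Real.cosh (β * y2 α β x2 t x)
    - √2 * μ * β * (α * Real.cos (α * y1 α β x1 t x) - β * Real.sin (α * y1 α β x1 t x))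
      / (α * √(α ^ 2 + β ^ 2) * √(Delta α β μ))

/-- The Gardner breather `B_{α,β,μ}(t,x;x₁,x₂) = 2√2 ∂ₓ[arctan(G/F)]`, with the derivative carried
out: `∂ₓ arctan(G/F) = (Gₓ F - G Fₓ)/(F² + G²)`. `F` may have isolated zeros in `x`, where `arctan(G/F)`
has to be continued to a smooth branch of the phase; the quotient is the derivative of every such
branch. See `hasDerivAt_arctan_eq_breather` for the points where `F ≠ 0`. -/
def breather (α β μ x1 x2 t x : ℝ) : ℝ :=
  2 * √2 *
    ((deriv (G α β μ x1 x2 t) x * F α β μ x1 x2 t x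
        - G α β μ x1 x2 t x * deriv (F α β μ x1 x2 t) x)
      / (F α β μ x1 x2 t x ^ 2 + G α β μ x1 x2 t x ^ 2))

theorem differentiable_G (α β μ x1 x2 t : ℝ) : Differentiable ℝ (G α β μ x1 x2 t) := by
  unfold G y1 y2
  fun_prop

theorem differentiable_F (α β μ x1 x2 t : ℝ) : Differentiable ℝ (F α β μ x1 x2 t) := by
  unfold F y1 y2
  fun_prop

/-- Wherever `F ≠ 0`, the breather is literally `∂ₓ[2√2 arctan(G/F)]`. -/
theorem hasDerivAt_arctan_eq_breather (α β μ x1 x2 t x : ℝ) (hF : F α β μ x1 x2 t x ≠ 0) :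
    HasDerivAt (fun s => 2 * √2 * Real.arctan (G α β μ x1 x2 t s / F α β μ x1 x2 t s))
      (breather α β μ x1 x2 t x) x := by
  have hg := (differentiable_G α β μ x1 x2 t x).hasDerivAt
  have hf := (differentiable_F α β μ x1 x2 t x).hasDerivAt
  have h := ((hg.div hf hF).arctan).const_mul (2 * √2)
  refine h.congr_deriv ?_
  have h2 : 0 < F α β μ x1 x2 t x ^ 2 + G α β μ x1 x2 t x ^ 2 := by positivity
  have h3 : 1 + (G α β μ x1 x2 t x / F α β μ x1 x2 t x) ^ 2
      = (F α β μ x1 x2 t x ^ 2 + G α β μ x1 x2 t x ^ 2) / F α β μ x1 x2 t x ^ 2 := by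
    field_simp
  unfold breather
  simp only [Pi.div_apply]
  rw [h3]
  field_simp

/-- The `H²`-level functional `F_μ[w](t)` of the Gardner equation, for `w = w(t,x)`. -/
def functionalF (μ : ℝ) (w : ℝ → ℝ → ℝ) (t : ℝ) : ℝ :=
  1 / 2 * (∫ x, iteratedDeriv 2 (w t) x ^ 2)
    - 5 * μ * (∫ x, w t x * deriv (w t) x ^ 2)
    + 5 / 2 * μ ^ 2 * (∫ x, w t x ^ 4)
    - 5 / 2 * (∫ x, w t x ^ 2 * deriv (w t) x ^ 2)
    + 3 / 2 * μ * (∫ x, w t x ^ 5)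
    + 1 / 4 * (∫ x, w t x ^ 6)

/-- The integrals that make up `F_μ[w](t)` all converge absolutely. -/
def FunctionalFConverges (w : ℝ → ℝ → ℝ) (t : ℝ) : Prop :=
  MeasureTheory.Integrable (fun x => iteratedDeriv 2 (w t) x ^ 2) ∧
  MeasureTheory.Integrable (fun x => w t x * deriv (w t) x ^ 2) ∧
  MeasureTheory.Integrable (fun x => w t x ^ 4) ∧
  MeasureTheory.Integrable (fun x => w t x ^ 2 * deriv (w t) x ^ 2) ∧
  MeasureTheory.Integrable (fun x => w t x ^ 5) ∧
  MeasureTheory.Integrable (fun x => w t x ^ 6)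

end Gardner

end

/-! Fix `t`, which enters only through two phase shifts. Put `f = F + iG`, `c = √2 μ` and `f'/f = a
+ ib`; the breather is `2√2 b`. Since `F` and `G` combine two exponentials and two trigonometric
modes, `f'''' = K f'' + ρ f` with `K = β² - α²`, `ρ = α²β²`. The special coefficients add two
bilinear identities, for `Re (f̄ f'')` and `Im (f̄ f''')`, and these make `a`, `b` and `e = Im
(f''/f)` a closed polynomial system with an energy relation (`reducedFlow_of_bilinear`,
`PhaseData.reducedFlow`). Modulo that relation, the density of the functional is the derivative of a
polynomial in `a, b, e` minus `2c⁵b` (`ReducedFlow.hasDerivAt_primitive`). Its integral is therefore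
a boundary term, read off at `a = ±β`, `b = e = 0`, plus a multiple of the total change of `arg f`,
which is the arctangent.

This needs `f` to be zero-free and to have a controlled argument. One rotation gives both: if `T` is
the tangent of half the total angle, `Re ((1 + iT) f) = F - T G` dominates a multiple of `cosh`
(`PhaseData.exists_rotated_lower_bound`). So the arctangent of the rotated quotient is a global
branch of the phase. The same bound gives decay: the numerators of `b` and `e` lose their leading
exponentials, so both are `O(1/cosh)`. -/

noncomputable section

namespace Gardner

open MeasureTheory Filter Topology Asymptotics
open scoped BoundedContinuousFunction

/-! ### The reduced system and an exact primitive of the density. -/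

/-- The differential system, with its energy relation, satisfied by the real and imaginary parts
`a`, `b` of the logarithmic derivative of `F + iG` and by `e = Im (f'' / f)`. -/
structure ReducedFlow (c K ρ : ℝ) (a b e : ℝ → ℝ) : Prop where
  deriv_a : ∀ x, HasDerivAt a (2 * b x ^ 2 + c * b x) x
  deriv_b : ∀ x, HasDerivAt b (e x - 2 * a x * b x) x
  deriv_e : ∀ x, HasDerivAt e (K * b x - 2 * b x * (a x ^ 2 + b x ^ 2 + c * b x)) x
  energy : ∀ x, e x ^ 2 = K * (a x ^ 2 + b x ^ 2 + c * b x) + ρ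
    - (a x ^ 2 + b x ^ 2 + c * b x) ^ 2
    - 2 * c * (e x * a x - b x * (a x ^ 2 + b x ^ 2 + c * b x)) - c * K * b x

/-- The second derivative of `b` along a reduced flow. -/
def flowSecond (c K a b e : ℝ) : ℝ :=
  b * (K - 4 * b ^ 2 - 2 * (a ^ 2 + b ^ 2 + c * b) - 2 * c * b + 4 * a ^ 2) - 2 * a * e

/-- The density of `functionalF` for `2√2 b`, with `c = √2 μ`. -/
def flowDensity (c K a b e : ℝ) : ℝ :=
  4 * flowSecond c K a b e ^ 2 - 80 * c * b * (e - 2 * a * b) ^ 2 + 80 * c ^ 2 * b ^ 4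
    - 160 * b ^ 2 * (e - 2 * a * b) ^ 2 + 192 * c * b ^ 5 + 128 * b ^ 6

/-- The part of the antiderivative of `flowDensity` that is polynomial in the reduced variables. -/
def flowPrimitive (c K ρ a b e : ℝ) : ℝ :=
  32 / 5 * a ^ 5 + 4 / 3 * a ^ 3 * c ^ 2 - 8 * a ^ 3 * K + 16 * a ^ 2 * b * e
    + 12 * a ^ 2 * e * c + 96 * a * b ^ 4 + 64 * a * b ^ 3 * c - 4 * a * b ^ 2 * c ^ 2
    - 8 * a * b ^ 2 * K + 2 * a * c ^ 4 - 2 * a * c ^ 2 * K + 2 * a * K ^ 2 - 8 * a * ρ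
    - 48 * b ^ 3 * e - 36 * b ^ 2 * e * c + 2 * e * c ^ 3 - 2 * e * c * K

namespace ReducedFlow

variable {c K ρ : ℝ} {a b e : ℝ → ℝ}

theorem deriv_b' (h : ReducedFlow c K ρ a b e) (x : ℝ) :
    HasDerivAt (fun x => e x - 2 * a x * b x) (flowSecond c K (a x) (b x) (e x)) x := by
  refine ((h.deriv_e x).sub (((h.deriv_a x).const_mul 2).mul (h.deriv_b x))).congr_deriv ?_
  unfold flowSecond
  ring

/-- A polynomial identity that holds only modulo the energy relation, used with multiplier `16b² +
8cb`. The extra term `2c⁵b` is a multiple of the derivative of `arg f` and is integrated separately.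
-/
theorem hasDerivAt_primitive (h : ReducedFlow c K ρ a b e) (x : ℝ) :
    HasDerivAt (fun x => flowPrimitive c K ρ (a x) (b x) (e x))
      (flowDensity c K (a x) (b x) (e x) + 2 * c ^ 5 * b x) x := by
  have ha := h.deriv_a x
  have hb := h.deriv_b x
  have he := h.deriv_e x
  have H := (((((((((((((((((ha.pow 5).const_mul (32 / 5)).add
    (((ha.pow 3).const_mul (4 / 3)).mul_const (c ^ 2))).sub
    (((ha.pow 3).const_mul 8).mul_const K)).add
    ((((ha.pow 2).const_mul 16).mul hb).mul he)).add
    ((((ha.pow 2).const_mul 12).mul he).mul_const c)).add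
    ((ha.const_mul 96).mul (hb.pow 4))).add
    (((ha.const_mul 64).mul (hb.pow 3)).mul_const c)).sub
    (((ha.const_mul 4).mul (hb.pow 2)).mul_const (c ^ 2))).sub
    (((ha.const_mul 8).mul (hb.pow 2)).mul_const K)).add
    ((ha.const_mul 2).mul_const (c ^ 4))).sub
    (((ha.const_mul 2).mul_const (c ^ 2)).mul_const K)).add
    ((ha.const_mul 2).mul_const (K ^ 2))).sub
    ((ha.const_mul 8).mul_const ρ)).sub
    (((hb.pow 3).const_mul 48).mul he)).sub
    ((((hb.pow 2).const_mul 36).mul he).mul_const c)).add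
    ((he.const_mul 2).mul_const (c ^ 3))).sub
    (((he.const_mul 2).mul_const c).mul_const K)
  refine H.congr_deriv ?_
  simp only [Pi.pow_apply, Pi.mul_apply]
  unfold flowDensity flowSecond
  norm_num
  linear_combination (16 * b x ^ 2 + 8 * b x * c) * h.energy x

theorem continuous_a (h : ReducedFlow c K ρ a b e) : Continuous a :=
  continuous_iff_continuousAt.2 fun x => (h.deriv_a x).continuousAt

theorem continuous_b (h : ReducedFlow c K ρ a b e) : Continuous b :=
  continuous_iff_continuousAt.2 fun x => (h.deriv_b x).continuousAt

theorem continuous_e (h : ReducedFlow c K ρ a b e) : Continuous e :=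
  continuous_iff_continuousAt.2 fun x => (h.deriv_e x).continuousAt

end ReducedFlow

/-! ### Convergence and value of the functional along a reduced flow. -/

theorem integrable_mul_bounded {b : ℝ → ℝ} (hb : Integrable b) (f : ℝ →ᵇ ℝ) :
    Integrable (fun x => b x * f x) :=
  hb.mul_bdd f.continuous.aestronglyMeasurable
    (Eventually.of_forall fun x => f.norm_coe_le_norm x)

/-- A continuous function with a global bound, as a bounded continuous function. -/
theorem exists_boundedContinuous {f : ℝ → ℝ} (hf : Continuous f) {M : ℝ} (hM : ∀ x, |f x| ≤ M) :
    ∃ g : ℝ →ᵇ ℝ, ∀ x, g x = f x :=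
  ⟨BoundedContinuousFunction.ofNormedAddCommGroup f hf M hM, fun _ => rfl⟩

theorem integral_alternating_sum {f₁ f₂ f₃ f₄ f₅ f₆ : ℝ → ℝ} (h₁ : Integrable f₁)
    (h₂ : Integrable f₂) (h₃ : Integrable f₃) (h₄ : Integrable f₄) (h₅ : Integrable f₅)
    (h₆ : Integrable f₆) :
    ∫ x, f₁ x - f₂ x + f₃ x - f₄ x + f₅ x + f₆ x =
      (∫ x, f₁ x) - (∫ x, f₂ x) + (∫ x, f₃ x) - (∫ x, f₄ x) + (∫ x, f₅ x) + ∫ x, f₆ x := by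
  have i₂ : Integrable fun x => f₁ x - f₂ x := h₁.sub h₂
  have i₃ : Integrable fun x => f₁ x - f₂ x + f₃ x := i₂.add h₃
  have i₄ : Integrable fun x => f₁ x - f₂ x + f₃ x - f₄ x := i₃.sub h₄
  have i₅ : Integrable fun x => f₁ x - f₂ x + f₃ x - f₄ x + f₅ x := i₄.add h₅
  rw [integral_add i₅ h₆, integral_add i₄ h₅, integral_sub i₃ h₄, integral_add i₂ h₃,
    integral_sub h₁ h₂]

section Functional

variable {c K ρ M μ : ℝ} {a b e : ℝ → ℝ} {w : ℝ → ℝ → ℝ} {t : ℝ}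

theorem ReducedFlow.deriv_eq (h : ReducedFlow c K ρ a b e) (hw : w t = fun x => 2 * √2 * b x) :
    deriv (w t) = fun x => 2 * √2 * (e x - 2 * a x * b x) := by
  funext x
  rw [hw]
  exact ((h.deriv_b x).const_mul _).deriv

theorem ReducedFlow.iteratedDeriv_two_eq (h : ReducedFlow c K ρ a b e)
    (hw : w t = fun x => 2 * √2 * b x) :
    iteratedDeriv 2 (w t) = fun x => 2 * √2 * flowSecond c K (a x) (b x) (e x) := by
  rw [iteratedDeriv_succ, iteratedDeriv_one, h.deriv_eq hw]
  funext x
  exact ((h.deriv_b' x).const_mul _).deriv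

/-- Every integrand is a sum of terms containing a factor `b` or `e`, which is integrable, times a
polynomial in bounded functions. -/
theorem ReducedFlow.functionalFConverges (h : ReducedFlow c K ρ a b e)
    (hw : w t = fun x => 2 * √2 * b x) (hb : Integrable b) (he : Integrable e)
    (hMa : ∀ x, |a x| ≤ M) (hMb : ∀ x, |b x| ≤ M) (hMe : ∀ x, |e x| ≤ M) :
    FunctionalFConverges w t := by
  obtain ⟨A, hA⟩ := exists_boundedContinuous h.continuous_a hMa
  obtain ⟨B, hB⟩ := exists_boundedContinuous h.continuous_b hMb
  obtain ⟨E, hE⟩ := exists_boundedContinuous h.continuous_e hMe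
  have hd := h.deriv_eq hw
  have hdd := h.iteratedDeriv_two_eq hw
  have hb' := fun f : ℝ →ᵇ ℝ => integrable_mul_bounded hb f
  have he' := fun f : ℝ →ᵇ ℝ => integrable_mul_bounded he f
  let k : ℝ → (ℝ →ᵇ ℝ) := fun r => BoundedContinuousFunction.const ℝ r
  have hk : ∀ r x, k r x = r := fun _ _ => rfl
  unfold FunctionalFConverges
  rw [hd, hdd, hw]
  let U : ℝ →ᵇ ℝ := k K - k 4 * (B * B) - k 2 * (A * A + B * B + k c * B) - k 2 * k c * B
    + k 4 * (A * A)
  let S : ℝ →ᵇ ℝ := B * U - k 2 * A * E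
  let D : ℝ →ᵇ ℝ := E - k 2 * A * B
  let s : ℝ →ᵇ ℝ := k (2 * √2)
  refine ⟨?_, ?_, ?_, ?_, ?_, ?_⟩
  -- The second derivative is proportional to `S = bU - 2ae`. One factor of the square is split this
  -- way; the other stays as a bounded `S`.
  · refine ((hb' (s * s * U * S)).add (he' (-(s * s * k 2 * A * S)))).congr (ae_of_all _ fun x => ?_)
    simp [U, S, s, hk, hA, hB, hE, flowSecond]
    ring
  · refine (hb' (s * s * s * D * D)).congr (ae_of_all _ fun x => ?_)
    simp [D, s, hk, hA, hB, hE]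
    ring
  · refine (hb' (s * s * s * s * B * B * B)).congr (ae_of_all _ fun x => ?_)
    simp [s, hk, hB]
    ring
  · refine (hb' (s * s * s * s * B * D * D)).congr (ae_of_all _ fun x => ?_)
    simp [D, s, hk, hA, hB, hE]
    ring
  · refine (hb' (s * s * s * s * s * B * B * B * B)).congr (ae_of_all _ fun x => ?_)
    simp [s, hk, hB]
    ring
  · refine (hb' (s * s * s * s * s * s * B * B * B * B * B)).congr (ae_of_all _ fun x => ?_)
    simp [s, hk, hB]
    ring

theorem ReducedFlow.functionalF_eq (h : ReducedFlow c K ρ a b e) (hc : c = √2 * μ)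
    (hw : w t = fun x => 2 * √2 * b x) (hconv : FunctionalFConverges w t) :
    Integrable (fun x => flowDensity c K (a x) (b x) (e x)) ∧
    functionalF μ w t = ∫ x, flowDensity c K (a x) (b x) (e x) := by
  obtain ⟨h1, h2, h3, h4, h5, h6⟩ := hconv
  have i1 := h1.const_mul (1 / 2)
  have i2 := h2.const_mul (5 * μ)
  have i3 := h3.const_mul (5 / 2 * μ ^ 2)
  have i4 := h4.const_mul (5 / 2)
  have i5 := h5.const_mul (3 / 2 * μ)
  have i6 := h6.const_mul (1 / 4)
  have key : (fun x => flowDensity c K (a x) (b x) (e x)) = fun x =>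
      1 / 2 * iteratedDeriv 2 (w t) x ^ 2 - 5 * μ * (w t x * deriv (w t) x ^ 2)
        + 5 / 2 * μ ^ 2 * w t x ^ 4 - 5 / 2 * (w t x ^ 2 * deriv (w t) x ^ 2)
        + 3 / 2 * μ * w t x ^ 5 + 1 / 4 * w t x ^ 6 := by
    funext x
    rw [h.deriv_eq hw, h.iteratedDeriv_two_eq hw, hw]
    have hs : √2 ^ 2 = (2 : ℝ) := Real.sq_sqrt (by norm_num)
    have hs3 : √2 ^ 3 = 2 * √2 := by rw [pow_succ, hs]
    have hs4 : √2 ^ 4 = (4 : ℝ) := by rw [show (4 : ℕ) = 2 * 2 by rfl, pow_mul, hs]; norm_num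
    have hs5 : √2 ^ 5 = 4 * √2 := by rw [pow_succ, hs4]
    have hs6 : √2 ^ 6 = (8 : ℝ) := by rw [pow_succ, hs5, mul_assoc, ← sq, hs]; norm_num
    simp only [flowDensity, hc, mul_pow, hs, hs4, hs5, hs6]
    ring
  constructor
  · rw [key]
    exact ((((i1.sub i2).add i3).sub i4).add i5).add i6
  · rw [key]
    unfold functionalF
    rw [integral_alternating_sum i1 i2 i3 i4 i5 i6]
    simp only [integral_const_mul]

end Functional

/-! ### From bilinear identities to the reduced system. -/

/-- Bilinear identities for a pair of solutions of `f'''' = K f'' + ρ f` give a reduced flow. -/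
theorem reducedFlow_of_bilinear {c K ρ : ℝ} {F₀ F₁ F₂ F₃ G₀ G₁ G₂ G₃ : ℝ → ℝ}
    (hF₀ : ∀ x, HasDerivAt F₀ (F₁ x) x) (hF₁ : ∀ x, HasDerivAt F₁ (F₂ x) x)
    (hF₂ : ∀ x, HasDerivAt F₂ (F₃ x) x) (hF₃ : ∀ x, HasDerivAt F₃ (K * F₂ x + ρ * F₀ x) x)
    (hG₀ : ∀ x, HasDerivAt G₀ (G₁ x) x) (hG₁ : ∀ x, HasDerivAt G₁ (G₂ x) x)
    (hG₂ : ∀ x, HasDerivAt G₂ (G₃ x) x) (hG₃ : ∀ x, HasDerivAt G₃ (K * G₂ x + ρ * G₀ x) x)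
    (hN : ∀ x, 0 < F₀ x ^ 2 + G₀ x ^ 2)
    (hQ : ∀ x, F₀ x * F₂ x + G₀ x * G₂ x - F₁ x ^ 2 - G₁ x ^ 2
      = c * (F₀ x * G₁ x - G₀ x * F₁ x))
    (hR : ∀ x, F₀ x * G₃ x - G₀ x * F₃ x
      = F₁ x * G₂ x - G₁ x * F₂ x + K * (F₀ x * G₁ x - G₀ x * F₁ x)) :
    ReducedFlow c K ρ (fun x => (F₀ x * F₁ x + G₀ x * G₁ x) / (F₀ x ^ 2 + G₀ x ^ 2))
      (fun x => (F₀ x * G₁ x - G₀ x * F₁ x) / (F₀ x ^ 2 + G₀ x ^ 2))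
      (fun x => (F₀ x * G₂ x - G₀ x * F₂ x) / (F₀ x ^ 2 + G₀ x ^ 2)) := by
  -- `hQ` is differentiated twice. The second time `f''''` is replaced through the linear equation,
  -- and the result relates `|f''|²` to lower-order quantities; this becomes the energy relation.
  have hQ₂ : ∀ x, F₀ x * F₃ x + G₀ x * G₃ x - F₁ x * F₂ x - G₁ x * G₂ x
      = c * (F₀ x * G₂ x - G₀ x * F₂ x) := fun x => by
    have h₁ := ((((hF₀ x).mul (hF₂ x)).add ((hG₀ x).mul (hG₂ x))).sub ((hF₁ x).pow 2)).sub
      ((hG₁ x).pow 2)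
    have h₂ := (((hF₀ x).mul (hG₁ x)).sub ((hG₀ x).mul (hF₁ x))).const_mul c
    have h := h₁.unique (h₂.congr_of_eventuallyEq (Eventually.of_forall hQ))
    simp only [Nat.cast_ofNat, Nat.add_one_sub_one, pow_one] at h
    linear_combination h
  have hQ₃ : ∀ x, F₀ x * (K * F₂ x + ρ * F₀ x) + G₀ x * (K * G₂ x + ρ * G₀ x)
      - F₂ x ^ 2 - G₂ x ^ 2
      = c * (F₀ x * G₃ x - G₀ x * F₃ x + F₁ x * G₂ x - G₁ x * F₂ x) := fun x => by
    have h₁ := ((((hF₀ x).mul (hF₃ x)).add ((hG₀ x).mul (hG₃ x))).sub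
      ((hF₁ x).mul (hF₂ x))).sub ((hG₁ x).mul (hG₂ x))
    have h₂ := (((hF₀ x).mul (hG₂ x)).sub ((hG₀ x).mul (hF₂ x))).const_mul c
    have h := h₁.unique (h₂.congr_of_eventuallyEq (Eventually.of_forall hQ₂))
    linear_combination h
  have hN' : ∀ x, F₀ x ^ 2 + G₀ x ^ 2 ≠ 0 := fun x => (hN x).ne'
  have hNd : ∀ x, HasDerivAt (fun x => F₀ x ^ 2 + G₀ x ^ 2)
      (2 * (F₀ x * F₁ x + G₀ x * G₁ x)) x := fun x => by
    refine (((hF₀ x).pow 2).add ((hG₀ x).pow 2)).congr_deriv ?_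
    norm_num
    ring
  -- This eliminates `Re (f''/f)` in favour of `a` and `b`, which is what closes the system.
  have hr : ∀ x, ((F₀ x * F₁ x + G₀ x * G₁ x) / (F₀ x ^ 2 + G₀ x ^ 2)) ^ 2
      + ((F₀ x * G₁ x - G₀ x * F₁ x) / (F₀ x ^ 2 + G₀ x ^ 2)) ^ 2
      + c * ((F₀ x * G₁ x - G₀ x * F₁ x) / (F₀ x ^ 2 + G₀ x ^ 2))
      = (F₀ x * F₂ x + G₀ x * G₂ x) / (F₀ x ^ 2 + G₀ x ^ 2) := fun x => by
    have := hN' x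
    field_simp
    linear_combination -(F₀ x ^ 2 + G₀ x ^ 2) * hQ x
  refine ⟨fun x => ?_, fun x => ?_, fun x => ?_, fun x => ?_⟩
  · refine ((((hF₀ x).mul (hF₁ x)).add ((hG₀ x).mul (hG₁ x))).div (hNd x) (hN' x)).congr_deriv ?_
    have := hN' x
    simp only [Pi.add_apply, Pi.mul_apply]
    field_simp
    linear_combination (F₀ x ^ 2 + G₀ x ^ 2) * hQ x
  · refine ((((hF₀ x).mul (hG₁ x)).sub ((hG₀ x).mul (hF₁ x))).div (hNd x) (hN' x)).congr_deriv ?_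
    have := hN' x
    simp only [Pi.sub_apply, Pi.mul_apply]
    field_simp
    ring
  · refine ((((hF₀ x).mul (hG₂ x)).sub ((hG₀ x).mul (hF₂ x))).div (hNd x) (hN' x)).congr_deriv ?_
    rw [hr]
    have := hN' x
    simp only [Pi.sub_apply, Pi.mul_apply]
    field_simp
    linear_combination (F₀ x ^ 2 + G₀ x ^ 2) * hR x
  -- Used here: `|f''/f|² = e² + (a² + b² + cb)²` and `Im (f̄' f'')/|f|² = ea - b(a² + b² + cb)`.
  · rw [hr]
    have := hN' x
    field_simp
    linear_combination (-(F₀ x ^ 2 + G₀ x ^ 2)) * hQ₃ x - (F₀ x ^ 2 + G₀ x ^ 2) * c * hR x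

/-! ### Exponential and trigonometric modes: derivatives, growth, positivity. -/

/-- The general solution of `f'''' = (β² - α²) f'' + α² β² f`, with phase shifts `u`, `v`. -/
def modes (α β u v p q r s x : ℝ) : ℝ :=
  p * Real.exp (β * (x + v)) + q * Real.exp (-(β * (x + v))) + r * Real.cos (α * (x + u))
    + s * Real.sin (α * (x + u))

theorem hasDerivAt_modes (α β u v p q r s x : ℝ) :
    HasDerivAt (modes α β u v p q r s)
      (modes α β u v (β * p) (-β * q) (α * s) (-α * r) x) x := by
  have hX : HasDerivAt (fun x => β * (x + v)) β x := by
    simpa using ((hasDerivAt_id x).add_const v).const_mul β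
  have hY : HasDerivAt (fun x => α * (x + u)) α x := by
    simpa using ((hasDerivAt_id x).add_const u).const_mul α
  refine ((((hX.exp.const_mul p).add (hX.neg.exp.const_mul q)).add (hY.cos.const_mul r)).add
    (hY.sin.const_mul s)).congr_deriv ?_
  simp only [modes, Pi.neg_apply]
  ring

section Growth

/-- The bounded part of `modes`. -/
def trigPart (α u r s x : ℝ) : ℝ :=
  r * Real.cos (α * (x + u)) + s * Real.sin (α * (x + u))

variable (α β u v p q r s : ℝ) {l : Filter ℝ}

theorem trigPart_isBigO_one : trigPart α u r s =O[⊤] fun _ => (1 : ℝ) := by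
  refine IsBigO.add ?_ ?_
  · refine IsBigO.const_mul_left ?_ r
    exact isBigO_top.2 ⟨1, fun x => by simpa using Real.abs_cos_le_one _⟩
  · refine IsBigO.const_mul_left ?_ s
    exact isBigO_top.2 ⟨1, fun x => by simpa using Real.abs_sin_le_one _⟩

theorem modes_eq (x : ℝ) : modes α β u v p q r s x =
    p * Real.exp (β * (x + v)) + q * Real.exp (-(β * (x + v))) + trigPart α u r s x := by
  simp only [modes, trigPart]
  ring

theorem tendsto_trigPart_mul {g : ℝ → ℝ} (hg : Tendsto g l (𝓝 0)) :
    Tendsto (fun x => g x * trigPart α u r s x) l (𝓝 0) :=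
  hg.zero_mul_isBoundedUnder_le
    ((isBigO_one_iff ℝ).1 ((trigPart_isBigO_one α u r s).mono le_top))

theorem tendsto_exp_neg_mul_modes (hl : Tendsto (fun x => β * (x + v)) l atTop) :
    Tendsto (fun x => Real.exp (-(β * (x + v))) * modes α β u v p q r s x) l (𝓝 p) := by
  have hE : Tendsto (fun x => Real.exp (-(β * (x + v)))) l (𝓝 0) :=
    Real.tendsto_exp_neg_atTop_nhds_zero.comp hl
  have h := ((((hE.mul hE).const_mul q).add (tendsto_trigPart_mul α u r s hE)).const_add p)
  simp only [mul_zero, add_zero] at h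
  refine h.congr fun x => ?_
  have h1 : Real.exp (-(β * (x + v))) * Real.exp (β * (x + v)) = 1 := by
    rw [← Real.exp_add]; simp
  rw [modes_eq]
  linear_combination -p * h1

theorem tendsto_exp_mul_modes (hl : Tendsto (fun x => β * (x + v)) l atBot) :
    Tendsto (fun x => Real.exp (β * (x + v)) * modes α β u v p q r s x) l (𝓝 q) := by
  have hE : Tendsto (fun x => Real.exp (β * (x + v))) l (𝓝 0) :=
    Real.tendsto_exp_atBot.comp hl
  have h := ((((hE.mul hE).const_mul p).add (tendsto_trigPart_mul α u r s hE)).const_add q)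
  simp only [mul_zero, add_zero] at h
  refine h.congr fun x => ?_
  have h1 : Real.exp (-(β * (x + v))) * Real.exp (β * (x + v)) = 1 := by
    rw [← Real.exp_add]; simp
  rw [modes_eq]
  linear_combination -q * h1

theorem exp_isBigO_cosh :
    (fun x => Real.exp (β * (x + v))) =O[⊤] fun x => Real.cosh (β * (x + v)) := by
  refine isBigO_top.2 ⟨2, fun x => ?_⟩
  rw [Real.norm_of_nonneg (Real.exp_pos _).le, Real.norm_of_nonneg (Real.cosh_pos _).le,
    Real.cosh_eq]
  have := Real.exp_pos (-(β * (x + v)))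
  linarith

theorem exp_neg_isBigO_cosh :
    (fun x => Real.exp (-(β * (x + v)))) =O[⊤] fun x => Real.cosh (β * (x + v)) := by
  refine isBigO_top.2 ⟨2, fun x => ?_⟩
  rw [Real.norm_of_nonneg (Real.exp_pos _).le, Real.norm_of_nonneg (Real.cosh_pos _).le,
    Real.cosh_eq]
  have := Real.exp_pos (β * (x + v))
  linarith

theorem one_isBigO_cosh : (fun _ => (1 : ℝ)) =O[⊤] fun x => Real.cosh (β * (x + v)) := by
  refine isBigO_top.2 ⟨1, fun x => ?_⟩
  rw [Real.norm_of_nonneg (Real.cosh_pos _).le]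
  simp [Real.one_le_cosh]

theorem modes_isBigO_cosh :
    modes α β u v p q r s =O[⊤] fun x => Real.cosh (β * (x + v)) := by
  have h := (((exp_isBigO_cosh β v).const_mul_left p).add
    ((exp_neg_isBigO_cosh β v).const_mul_left q)).add
    ((trigPart_isBigO_one α u r s).trans (one_isBigO_cosh β v))
  exact h.congr_left fun x => (modes_eq α β u v p q r s x).symm

/-- If the coefficients of `e^{2X}` and `e^{-2X}` cancel, a difference of products of modes
grows only like `cosh X`. -/
theorem modes_mul_sub_isBigO_cosh {p₁ q₁ p₂ q₂ p₃ q₃ p₄ q₄ : ℝ} (r₁ s₁ r₂ s₂ r₃ s₃ r₄ s₄ : ℝ)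
    (hp : p₁ * p₂ = p₃ * p₄) (hq : q₁ * q₂ = q₃ * q₄) :
    (fun x => modes α β u v p₁ q₁ r₁ s₁ x * modes α β u v p₂ q₂ r₂ s₂ x
      - modes α β u v p₃ q₃ r₃ s₃ x * modes α β u v p₄ q₄ r₄ s₄ x) =O[⊤]
      fun x => Real.cosh (β * (x + v)) := by
  have hE := exp_isBigO_cosh β v
  have hE' := exp_neg_isBigO_cosh β v
  have h1 := one_isBigO_cosh β v
  have t₁ := trigPart_isBigO_one α u r₁ s₁
  have t₂ := trigPart_isBigO_one α u r₂ s₂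
  have t₃ := trigPart_isBigO_one α u r₃ s₃
  have t₄ := trigPart_isBigO_one α u r₄ s₄
  have hk := h1.const_mul_left (p₁ * q₂ + q₁ * p₂ - p₃ * q₄ - q₃ * p₄)
  have hA := hE.mul ((((t₂.const_mul_left p₁).add (t₁.const_mul_left p₂)).sub
    (t₄.const_mul_left p₃)).sub (t₃.const_mul_left p₄))
  have hB := hE'.mul ((((t₂.const_mul_left q₁).add (t₁.const_mul_left q₂)).sub
    (t₄.const_mul_left q₃)).sub (t₃.const_mul_left q₄))
  have hC := (t₁.mul t₂).sub (t₃.mul t₄)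
  simp only [mul_one] at hA hB hC
  refine (((hk.add hA).add hB).add (hC.trans h1)).congr_left fun x => ?_
  have hEE : Real.exp (-(β * (x + v))) * Real.exp (β * (x + v)) = 1 := by
    rw [← Real.exp_add]; simp
  simp only [modes_eq]
  linear_combination (-(p₁ * q₂ + q₁ * p₂ - p₃ * q₄ - q₃ * p₄)) * hEE
    - Real.exp (β * (x + v)) ^ 2 * hp - Real.exp (-(β * (x + v))) ^ 2 * hq

theorem integrable_inv_cosh (hβ : β ≠ 0) :
    Integrable fun x => (Real.cosh (β * (x + v)))⁻¹ := by
  -- The constant 4 comes from `cosh y ≥ (1 + |y| + y²/2)/2 ≥ (1 + y²)/4`.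
  have h := (((integrable_inv_one_add_sq.comp_mul_left' hβ).comp_add_right v).const_mul 4)
  refine h.mono' ?_ (ae_of_all _ fun x => ?_)
  · refine (Continuous.inv₀ (by fun_prop) fun x => (Real.cosh_pos _).ne').aestronglyMeasurable
  · rw [Real.norm_of_nonneg (inv_pos.2 (Real.cosh_pos _)).le, ← div_eq_mul_inv,
      inv_le_comm₀ (Real.cosh_pos _) (by positivity), inv_div, ← Real.cosh_abs, Real.cosh_eq]
    have h1 := Real.quadratic_le_exp_of_nonneg (abs_nonneg (β * (x + v)))
    rw [sq_abs] at h1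
    have h2 := Real.exp_pos (-|β * (x + v)|)
    have h3 := abs_nonneg (β * (x + v))
    linarith

end Growth

/-- The `n`-th derivative of `modes`. -/
def jet (α β u v : ℝ) : ℕ → ℝ → ℝ → ℝ → ℝ → ℝ → ℝ
  | 0, p, q, r, s => modes α β u v p q r s
  | n + 1, p, q, r, s => jet α β u v n (β * p) (-β * q) (α * s) (-α * r)

theorem hasDerivAt_jet (α β u v : ℝ) (n : ℕ) (p q r s x : ℝ) :
    HasDerivAt (jet α β u v n p q r s) (jet α β u v (n + 1) p q r s x) x := by
  induction n generalizing p q r s with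
  | zero => exact hasDerivAt_modes α β u v p q r s x
  | succ n ih => exact ih _ _ _ _

theorem jet_four (α β u v p q r s x : ℝ) : jet α β u v 4 p q r s x =
    (β ^ 2 - α ^ 2) * jet α β u v 2 p q r s x + α ^ 2 * β ^ 2 * jet α β u v 0 p q r s x := by
  simp only [jet, modes]
  ring

/-- Relations between the coefficients of the breather phase, with `c = √2 μ`; the number `T` is
the tangent of half the angle `arctan (2 c β / Δ)`. -/
structure PhaseData (α β c g τ T : ℝ) : Prop where
  alpha_ne : α ≠ 0
  beta_ne : β ≠ 0
  c_ne : c ≠ 0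
  delta_pos : 0 < α ^ 2 + β ^ 2 - c ^ 2
  exp_coeff : g * (α ^ 2 + β ^ 2 - c ^ 2) = c * β
  trig_coeff : τ ^ 2 * α ^ 2 * (α ^ 2 + β ^ 2) * (α ^ 2 + β ^ 2 - c ^ 2) = β ^ 2
  tan_sq_lt : T ^ 2 < 1
  tan_eq : c * β * (1 - T ^ 2) = T * (α ^ 2 + β ^ 2 - c ^ 2)

/-- The derivatives of `F`. -/
def jetF (α β u v c τ : ℝ) (n : ℕ) : ℝ → ℝ :=
  jet α β u v n (1 / 2) (1 / 2) (-(c * α * τ)) (c * β * τ)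

/-- The derivatives of `G`. -/
def jetG (α β u v g τ : ℝ) (n : ℕ) : ℝ → ℝ :=
  jet α β u v n (-g) 0 0 ((α ^ 2 + β ^ 2) * τ)

/-- `Re (f' / f)` for the phase `f = F + iG`. -/
def flowA (α β u v c g τ x : ℝ) : ℝ :=
  (jetF α β u v c τ 0 x * jetF α β u v c τ 1 x + jetG α β u v g τ 0 x * jetG α β u v g τ 1 x)
    / (jetF α β u v c τ 0 x ^ 2 + jetG α β u v g τ 0 x ^ 2)

/-- `Im (f' / f)` for the phase `f = F + iG`. -/
def flowB (α β u v c g τ x : ℝ) : ℝ :=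
  (jetF α β u v c τ 0 x * jetG α β u v g τ 1 x - jetG α β u v g τ 0 x * jetF α β u v c τ 1 x)
    / (jetF α β u v c τ 0 x ^ 2 + jetG α β u v g τ 0 x ^ 2)

/-- `Im (f'' / f)` for the phase `f = F + iG`. -/
def flowE (α β u v c g τ x : ℝ) : ℝ :=
  (jetF α β u v c τ 0 x * jetG α β u v g τ 2 x - jetG α β u v g τ 0 x * jetF α β u v c τ 2 x)
    / (jetF α β u v c τ 0 x ^ 2 + jetG α β u v g τ 0 x ^ 2)

/-- A combination of modes with positive exponential coefficients that dominate the trigonometric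
part is bounded below by a multiple of `cosh X`. -/
theorem exists_cosh_le_modes (α β u v : ℝ) {A r s : ℝ} (hA : 1 / 2 ≤ A)
    (h : r ^ 2 + s ^ 2 < 2 * A) :
    ∃ k > 0, ∀ x, k * Real.cosh (β * (x + v)) ≤ modes α β u v A (1 / 2) r s x := by
  have hA0 : 0 < √(2 * A) := Real.sqrt_pos.2 (by linarith)
  have hA2 : √(2 * A) ^ 2 = 2 * A := Real.sq_sqrt (by linarith)
  have hlt : √(r ^ 2 + s ^ 2) < √(2 * A) := Real.sqrt_lt_sqrt (by positivity) h
  have hlam : √(r ^ 2 + s ^ 2) / √(2 * A) < 1 := (div_lt_one hA0).2 hlt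
  have hlam0 : 0 ≤ √(r ^ 2 + s ^ 2) / √(2 * A) := by positivity
  have hlamA : √(r ^ 2 + s ^ 2) / √(2 * A) * √(2 * A) = √(r ^ 2 + s ^ 2) :=
    div_mul_cancel₀ _ hA0.ne'
  set L := √(r ^ 2 + s ^ 2) / √(2 * A)
  -- By AM-GM the exponential part is at least `√(2A)`. The trigonometric part can consume at most
  -- the fraction `L` of it; the remaining `1 - L` controls `cosh` because `A ≥ 1/2`.
  refine ⟨1 - L, by linarith, fun x => ?_⟩
  have hE := Real.exp_pos (β * (x + v))
  have hE' := Real.exp_pos (-(β * (x + v)))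
  have hEE : Real.exp (-(β * (x + v))) * Real.exp (β * (x + v)) = 1 := by
    rw [← Real.exp_add]; simp
  have hcs := Real.sin_sq_add_cos_sq (α * (x + u))
  have htrig : -√(r ^ 2 + s ^ 2) ≤
      r * Real.cos (α * (x + u)) + s * Real.sin (α * (x + u)) := by
    refine Real.neg_sqrt_le_of_sq_le ?_
    nlinarith [sq_nonneg (r * Real.sin (α * (x + u)) - s * Real.cos (α * (x + u)))]
  rw [modes, Real.cosh_eq]
  set E := Real.exp (β * (x + v))
  set E' := Real.exp (-(β * (x + v)))
  have hamgm : √(2 * A) ≤ A * E + 1 / 2 * E' := by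
    have h1 : 0 ≤ E' * (√(2 * A) * E - 1) ^ 2 := by positivity
    have h2 : E' * (√(2 * A) * E - 1) ^ 2 = 2 * (A * E + 1 / 2 * E') - 2 * √(2 * A) := by
      linear_combination (E' * E ^ 2) * hA2 + (2 * A * E - 2 * √(2 * A)) * hEE
    linarith
  have h3 : (1 - L) * ((E + E') / 2) ≤ (1 - L) * (A * E + 1 / 2 * E') :=
    mul_le_mul_of_nonneg_left (by nlinarith) (by linarith)
  have h4 : L * √(2 * A) ≤ L * (A * E + 1 / 2 * E') := mul_le_mul_of_nonneg_left hamgm hlam0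
  linarith

/-- With `tan θ = 2cβ/D`, the witness is `T = tan (θ/2) = sin θ/(1 + cos θ)`, the root of `cβT² + DT
- cβ = 0` of modulus below 1. -/
theorem exists_phaseData {α β c : ℝ} (hα : α ≠ 0) (hβ : β ≠ 0) (hc : c ≠ 0)
    (hΔ : 0 < α ^ 2 + β ^ 2 - c ^ 2) :
    ∃ T, PhaseData α β c (c * β / (α ^ 2 + β ^ 2 - c ^ 2))
      (β / (α * √(α ^ 2 + β ^ 2) * √(α ^ 2 + β ^ 2 - c ^ 2))) T := by
  set D := α ^ 2 + β ^ 2 - c ^ 2 with hD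
  have hs : 0 < α ^ 2 + β ^ 2 := by positivity
  have hR : √(D ^ 2 + 4 * c ^ 2 * β ^ 2) ^ 2 = D ^ 2 + 4 * c ^ 2 * β ^ 2 :=
    Real.sq_sqrt (by positivity)
  have hR0 : 0 ≤ √(D ^ 2 + 4 * c ^ 2 * β ^ 2) := Real.sqrt_nonneg _
  set R := √(D ^ 2 + 4 * c ^ 2 * β ^ 2)
  have hDR : 0 < D + R := by linarith
  have hT : 2 * c * β / (D + R) * (D + R) = 2 * c * β := div_mul_cancel₀ _ hDR.ne'
  set T := 2 * c * β / (D + R)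
  have hT2 : T ^ 2 * (D + R) = R - D := by
    refine mul_right_cancel₀ hDR.ne' ?_
    linear_combination (T * (D + R) + 2 * c * β) * hT - hR
  refine ⟨T, hα, hβ, hc, hΔ, div_mul_cancel₀ _ hΔ.ne', ?_, ?_, ?_⟩
  · rw [← hD, div_pow, mul_pow, mul_pow, Real.sq_sqrt hs.le, Real.sq_sqrt hΔ.le]
    field_simp
  · by_contra! hle
    have := mul_le_mul_of_nonneg_right hle hDR.le
    linarith
  · refine mul_right_cancel₀ hDR.ne' ?_
    rw [← hD]
    linear_combination (-(c * β)) * hT2 - D * hT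

theorem rotated_eq (α β u v c g τ T x : ℝ) : jetF α β u v c τ 0 x - T * jetG α β u v g τ 0 x =
    modes α β u v (1 / 2 + T * g) (1 / 2) (-(c * α * τ))
      (c * β * τ - T * ((α ^ 2 + β ^ 2) * τ)) x := by
  simp only [jetF, jetG, jet, modes]
  ring

/-! ### The phase has no zeros. -/

namespace PhaseData

variable {α β c g τ T : ℝ} (h : PhaseData α β c g τ T)
include h

/-- Equivalently `2g = tan (2 arctan T)`: the limiting argument of `f` at the growing end of `G` is
`-2 arctan T`. -/
theorem exp_coeff_tan : g * (1 - T ^ 2) = T := by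
  refine mul_right_cancel₀ h.delta_pos.ne' ?_
  linear_combination (1 - T ^ 2) * h.exp_coeff + h.tan_eq

theorem tan_mul_pos : 0 < T * c * β := by
  have hT : 0 < 1 - T ^ 2 := by linarith [h.tan_sq_lt]
  have hcb : 0 < (c * β) ^ 2 := by have := h.c_ne; have := h.beta_ne; positivity
  have h1 : (T * c * β) * (α ^ 2 + β ^ 2 - c ^ 2) = (c * β) ^ 2 * (1 - T ^ 2) := by
    linear_combination (-(c * β)) * h.tan_eq
  exact pos_of_mul_pos_left (h1 ▸ mul_pos hcb hT) h.delta_pos.le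

theorem half_le : 1 / 2 ≤ 1 / 2 + T * g := by
  have hT : 0 < 1 - T ^ 2 := by linarith [h.tan_sq_lt]
  have h1 : (T * g) * (1 - T ^ 2) = T ^ 2 := by linear_combination T * h.exp_coeff_tan
  have : 0 ≤ T * g := nonneg_of_mul_nonneg_left (by rw [h1]; positivity) hT
  linarith

/-- After multiplication by `1 - T²` the right side becomes `1 + T²` and the left side `(1 + T²)
T²β²/(Tcβ + β²)`. The latter is smaller because `Tcβ > 0` and `T² < 1`. -/
theorem amplitude_lt : (-(c * α * τ)) ^ 2 + (c * β * τ - T * ((α ^ 2 + β ^ 2) * τ)) ^ 2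
    < 2 * (1 / 2 + T * g) := by
  have hT : 0 < 1 - T ^ 2 := by linarith [h.tan_sq_lt]
  have hα : (c - T * β) * (T * c + β) = T * α ^ 2 := by linear_combination h.tan_eq
  have h1 : c * (T * c + β * (1 - T ^ 2)) = T * (α ^ 2 + β ^ 2) := by
    linear_combination h.tan_eq
  have h2 : c * β - T * (α ^ 2 + β ^ 2) = -(c * T * (c - β * T)) := by
    linear_combination h1
  set m := (-(c * α * τ)) ^ 2 + (c * β * τ - T * ((α ^ 2 + β ^ 2) * τ)) ^ 2 with hm
  have h3 : m * (T * c + β) = τ ^ 2 * α ^ 2 * (α ^ 2 + β ^ 2) * (c * (1 + T ^ 2) * T) := by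
    have : m = τ ^ 2 * c ^ 2 * (α ^ 2 + T ^ 2 * (c - β * T) ^ 2) := by
      rw [hm]
      linear_combination τ ^ 2 * (c * β - T * (α ^ 2 + β ^ 2) - c * T * (c - β * T)) * h2
    rw [this]
    linear_combination τ ^ 2 * c ^ 2 * T ^ 2 * (c - β * T) * hα
      + τ ^ 2 * α ^ 2 * c * (1 + T ^ 2) * h1
  have h4 : m * (1 - T ^ 2) * (T * c + β) = (1 + T ^ 2) * β * T ^ 2 := by
    refine mul_right_cancel₀ (mul_ne_zero h.c_ne h.beta_ne) ?_
    linear_combination m * (T * c + β) * h.tan_eq + T * (α ^ 2 + β ^ 2 - c ^ 2) * h3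
      + c * (1 + T ^ 2) * T ^ 2 * h.trig_coeff
  have h5 : 2 * (1 / 2 + T * g) * (1 - T ^ 2) = 1 + T ^ 2 := by
    linear_combination 2 * T * h.exp_coeff_tan
  have hpos := h.tan_mul_pos
  have hb : 0 < β ^ 2 := by have := h.beta_ne; positivity
  have h6 : m * (1 - T ^ 2) < 1 + T ^ 2 := by
    by_contra! hle
    have h7 : m * (1 - T ^ 2) * (T * c * β + β ^ 2) = (1 + T ^ 2) * (β ^ 2 * T ^ 2) := by
      linear_combination β * h4
    have h8 := mul_le_mul_of_nonneg_right hle (by positivity : 0 ≤ T * c * β + β ^ 2)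
    rw [h7] at h8
    have h9 := le_of_mul_le_mul_left h8 (by positivity)
    nlinarith [h.tan_sq_lt]
  exact lt_of_mul_lt_mul_right (h5 ▸ h6) hT.le

theorem exists_rotated_lower_bound (u v : ℝ) : ∃ k > 0, ∀ x,
    k * Real.cosh (β * (x + v)) ≤ jetF α β u v c τ 0 x - T * jetG α β u v g τ 0 x := by
  obtain ⟨k, hk, hle⟩ := exists_cosh_le_modes α β u v h.half_le h.amplitude_lt
  exact ⟨k, hk, fun x => rotated_eq α β u v c g τ T x ▸ hle x⟩

theorem rotated_pos (u v x : ℝ) :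
    0 < jetF α β u v c τ 0 x - T * jetG α β u v g τ 0 x := by
  obtain ⟨k, hk, hle⟩ := h.exists_rotated_lower_bound u v
  exact (mul_pos hk (Real.cosh_pos _)).trans_le (hle x)

/-- Cauchy-Schwarz: `(F - TG)² ≤ (1 + T²)(F² + G²)`, and the left side is positive. -/
theorem norm_sq_pos (u v x : ℝ) :
    0 < jetF α β u v c τ 0 x ^ 2 + jetG α β u v g τ 0 x ^ 2 := by
  have := h.rotated_pos u v x
  have h1 : (jetF α β u v c τ 0 x - T * jetG α β u v g τ 0 x) ^ 2
      ≤ (1 + T ^ 2) * (jetF α β u v c τ 0 x ^ 2 + jetG α β u v g τ 0 x ^ 2) := by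
    nlinarith [sq_nonneg (T * jetF α β u v c τ 0 x + jetG α β u v g τ 0 x)]
  exact pos_of_mul_pos_right ((pow_pos this 2).trans_le h1) (by positivity)

theorem inv_norm_sq_isBigO (u v : ℝ) :
    (fun x => (jetF α β u v c τ 0 x ^ 2 + jetG α β u v g τ 0 x ^ 2)⁻¹) =O[⊤]
      fun x => (Real.cosh (β * (x + v)))⁻¹ * (Real.cosh (β * (x + v)))⁻¹ := by
  obtain ⟨k, hk, hle⟩ := h.exists_rotated_lower_bound u v
  refine isBigO_top.2 ⟨(1 + T ^ 2) / k ^ 2, fun x => ?_⟩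
  have hN := h.norm_sq_pos u v x
  have hch := Real.cosh_pos (β * (x + v))
  have h1 : (jetF α β u v c τ 0 x - T * jetG α β u v g τ 0 x) ^ 2
      ≤ (1 + T ^ 2) * (jetF α β u v c τ 0 x ^ 2 + jetG α β u v g τ 0 x ^ 2) := by
    nlinarith [sq_nonneg (T * jetF α β u v c τ 0 x + jetG α β u v g τ 0 x)]
  have h2 : (k * Real.cosh (β * (x + v))) ^ 2
      ≤ (jetF α β u v c τ 0 x - T * jetG α β u v g τ 0 x) ^ 2 :=
    pow_le_pow_left₀ (by positivity) (hle x) 2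
  rw [Real.norm_of_nonneg (inv_pos.2 hN).le, Real.norm_of_nonneg (by positivity),
    show (1 + T ^ 2) / k ^ 2 * ((Real.cosh (β * (x + v)))⁻¹ * (Real.cosh (β * (x + v)))⁻¹)
      = (1 + T ^ 2) / (k * Real.cosh (β * (x + v))) ^ 2 by field_simp,
    inv_eq_one_div, div_le_div_iff₀ hN (by positivity)]
  linarith

end PhaseData

/-! ### Bilinear identities, decay and the global phase. -/

namespace PhaseData

variable {α β c g τ T : ℝ} (h : PhaseData α β c g τ T)
include h

theorem trig_coeff_exp : c * τ ^ 2 * α ^ 2 * (α ^ 2 + β ^ 2) = g * β := by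
  refine mul_right_cancel₀ h.delta_pos.ne' ?_
  linear_combination c * h.trig_coeff - β * h.exp_coeff

theorem trig_coeff_sq : α ^ 2 * (α ^ 2 + β ^ 2) ^ 2 * τ ^ 2 = β ^ 2 + c * g * β := by
  refine mul_right_cancel₀ h.delta_pos.ne' ?_
  linear_combination (α ^ 2 + β ^ 2) * h.trig_coeff - c * β * h.exp_coeff

/-- Coefficients are compared, with `X = β (x + v)`. The `e^{±2X}` terms and the
`e^{-X}`-trigonometric terms cancel identically, the `e^X`-trigonometric ones by `exp_coeff`, and
the constants from `e^X e^{-X}` and `sin² + cos²` balance by `trig_coeff_sq`. -/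
theorem bilinear_second (u v x : ℝ) :
    jetF α β u v c τ 0 x * jetF α β u v c τ 2 x + jetG α β u v g τ 0 x * jetG α β u v g τ 2 x
      - jetF α β u v c τ 1 x ^ 2 - jetG α β u v g τ 1 x ^ 2
      = c * (jetF α β u v c τ 0 x * jetG α β u v g τ 1 x
        - jetG α β u v g τ 0 x * jetF α β u v c τ 1 x) := by
  simp only [jetF, jetG, jet, modes]
  have hEE : Real.exp (β * (x + v)) * Real.exp (-(β * (x + v))) = 1 := by
    rw [← Real.exp_add]; simp
  have hcs := Real.sin_sq_add_cos_sq (α * (x + u))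
  set E := Real.exp (β * (x + v))
  set E' := Real.exp (-(β * (x + v)))
  set S := Real.sin (α * (x + u))
  set C := Real.cos (α * (x + u))
  linear_combination (β ^ 2 + c * g * β) * hEE - α ^ 2 * (α ^ 2 + β ^ 2) ^ 2 * τ ^ 2 * hcs
    - h.trig_coeff_sq
    + (2 * β * α * τ * E * C - (β ^ 2 - α ^ 2) * τ * E * S) * h.exp_coeff

/-- Here all mixed terms cancel identically; only the constants need a relation, `trig_coeff_exp`.
-/
theorem bilinear_third (u v x : ℝ) :
    jetF α β u v c τ 0 x * jetG α β u v g τ 3 x - jetG α β u v g τ 0 x * jetF α β u v c τ 3 x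
      = jetF α β u v c τ 1 x * jetG α β u v g τ 2 x - jetG α β u v g τ 1 x * jetF α β u v c τ 2 x
        + (β ^ 2 - α ^ 2) * (jetF α β u v c τ 0 x * jetG α β u v g τ 1 x
          - jetG α β u v g τ 0 x * jetF α β u v c τ 1 x) := by
  simp only [jetF, jetG, jet, modes]
  have hEE : Real.exp (β * (x + v)) * Real.exp (-(β * (x + v))) = 1 := by
    rw [← Real.exp_add]; simp
  have hcs := Real.sin_sq_add_cos_sq (α * (x + u))
  set E := Real.exp (β * (x + v))
  set E' := Real.exp (-(β * (x + v)))
  set S := Real.sin (α * (x + u))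
  set C := Real.cos (α * (x + u))
  linear_combination (-(g * β * (α ^ 2 + β ^ 2))) * hEE
    + c * α ^ 2 * τ ^ 2 * (α ^ 2 + β ^ 2) ^ 2 * hcs + (α ^ 2 + β ^ 2) * h.trig_coeff_exp

theorem reducedFlow (u v : ℝ) : ReducedFlow c (β ^ 2 - α ^ 2) (α ^ 2 * β ^ 2)
    (flowA α β u v c g τ) (flowB α β u v c g τ) (flowE α β u v c g τ) :=
  reducedFlow_of_bilinear (F₃ := jetF α β u v c τ 3) (G₃ := jetG α β u v g τ 3)
    (fun x => hasDerivAt_jet α β u v 0 _ _ _ _ x) (fun x => hasDerivAt_jet α β u v 1 _ _ _ _ x)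
    (fun x => hasDerivAt_jet α β u v 2 _ _ _ _ x)
    (fun x => (hasDerivAt_jet α β u v 3 _ _ _ _ x).congr_deriv (jet_four α β u v _ _ _ _ x))
    (fun x => hasDerivAt_jet α β u v 0 _ _ _ _ x) (fun x => hasDerivAt_jet α β u v 1 _ _ _ _ x)
    (fun x => hasDerivAt_jet α β u v 2 _ _ _ _ x)
    (fun x => (hasDerivAt_jet α β u v 3 _ _ _ _ x).congr_deriv (jet_four α β u v _ _ _ _ x))
    (h.norm_sq_pos u v) (h.bilinear_second u v) (h.bilinear_third u v)

theorem flowA_isBigO (u v : ℝ) : flowA α β u v c g τ =O[⊤] fun _ => (1 : ℝ) := by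
  have hF₀ : jetF α β u v c τ 0 =O[⊤] _ := modes_isBigO_cosh α β u v _ _ _ _
  have hF₁ : jetF α β u v c τ 1 =O[⊤] _ := modes_isBigO_cosh α β u v _ _ _ _
  have hG₀ : jetG α β u v g τ 0 =O[⊤] _ := modes_isBigO_cosh α β u v _ _ _ _
  have hG₁ : jetG α β u v g τ 1 =O[⊤] _ := modes_isBigO_cosh α β u v _ _ _ _
  have h1 := ((hF₀.mul hF₁).add (hG₀.mul hG₁)).mul (h.inv_norm_sq_isBigO u v)
  refine h1.congr (fun x => (div_eq_mul_inv _ _).symm) fun x => ?_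
  have := (Real.cosh_pos (β * (x + v))).ne'
  field_simp

/-- At either end `f'` is to leading order a real multiple `±β` of `f`, so `Im (f̄ f')` has no
`e^{±2X}` term and is `O(cosh X)`, against a denominator of order `cosh² X`. The explicit arguments
are the coefficients of the jets. -/
theorem flowB_isBigO (u v : ℝ) :
    flowB α β u v c g τ =O[⊤] fun x => (Real.cosh (β * (x + v)))⁻¹ := by
  have h1 := (modes_mul_sub_isBigO_cosh α β u v (p₁ := 1 / 2) (q₁ := 1 / 2) (p₂ := β * -g)
    (q₂ := -β * 0) (p₃ := -g) (q₃ := 0) (p₄ := β * (1 / 2)) (q₄ := -β * (1 / 2))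
    (-(c * α * τ)) (c * β * τ) (α * ((α ^ 2 + β ^ 2) * τ)) (-α * 0) 0 ((α ^ 2 + β ^ 2) * τ)
    (α * (c * β * τ)) (-α * -(c * α * τ)) (by ring) (by ring)).mul (h.inv_norm_sq_isBigO u v)
  refine h1.congr (fun x => (div_eq_mul_inv _ _).symm) fun x => ?_
  have := (Real.cosh_pos (β * (x + v))).ne'
  field_simp

theorem flowE_isBigO (u v : ℝ) :
    flowE α β u v c g τ =O[⊤] fun x => (Real.cosh (β * (x + v)))⁻¹ := by
  have h1 := (modes_mul_sub_isBigO_cosh α β u v (p₁ := 1 / 2) (q₁ := 1 / 2)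
    (p₂ := β * (β * -g)) (q₂ := -β * (-β * 0)) (p₃ := -g) (q₃ := 0) (p₄ := β * (β * (1 / 2)))
    (q₄ := -β * (-β * (1 / 2))) (-(c * α * τ)) (c * β * τ) (α * (-α * 0))
    (-α * (α * ((α ^ 2 + β ^ 2) * τ))) 0 ((α ^ 2 + β ^ 2) * τ)
    (α * (-α * -(c * α * τ))) (-α * (α * (c * β * τ))) (by ring) (by ring)).mul
    (h.inv_norm_sq_isBigO u v)
  refine h1.congr (fun x => (div_eq_mul_inv _ _).symm) fun x => ?_
  have := (Real.cosh_pos (β * (x + v))).ne'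
  field_simp

omit h in
theorem inv_cosh_isBigO_one (β v : ℝ) :
    (fun x => (Real.cosh (β * (x + v)))⁻¹) =O[⊤] fun _ => (1 : ℝ) :=
  isBigO_top.2 ⟨1, fun x => by
    rw [Real.norm_of_nonneg (inv_pos.2 (Real.cosh_pos _)).le]
    simpa using inv_le_one_of_one_le₀ (Real.one_le_cosh _)⟩

theorem exists_flow_bound (u v : ℝ) : ∃ M, (∀ x, |flowA α β u v c g τ x| ≤ M) ∧
    (∀ x, |flowB α β u v c g τ x| ≤ M) ∧ ∀ x, |flowE α β u v c g τ x| ≤ M := by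
  obtain ⟨Ma, ha⟩ := isBigO_top.1 (h.flowA_isBigO u v)
  obtain ⟨Mb, hb⟩ := isBigO_top.1 ((h.flowB_isBigO u v).trans (inv_cosh_isBigO_one β v))
  obtain ⟨Me, he⟩ := isBigO_top.1 ((h.flowE_isBigO u v).trans (inv_cosh_isBigO_one β v))
  simp only [norm_one, mul_one, Real.norm_eq_abs] at ha hb he
  exact ⟨max Ma (max Mb Me), fun x => (ha x).trans (le_max_left _ _),
    fun x => (hb x).trans ((le_max_left _ _).trans (le_max_right _ _)),
    fun x => (he x).trans ((le_max_right _ _).trans (le_max_right _ _))⟩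

omit h in
theorem integrable_of_isBigO_inv_cosh {f : ℝ → ℝ} {v : ℝ} (hβ : β ≠ 0) (hf : Continuous f)
    (hO : f =O[⊤] fun x => (Real.cosh (β * (x + v)))⁻¹) : Integrable f := by
  obtain ⟨C, hC⟩ := isBigO_top.1 hO
  exact (((integrable_inv_cosh β v hβ).norm).const_mul C).mono' hf.aestronglyMeasurable
    (ae_of_all _ hC)

theorem integrable_flowB (u v : ℝ) : Integrable (flowB α β u v c g τ) :=
  integrable_of_isBigO_inv_cosh h.beta_ne (h.reducedFlow u v).continuous_b (h.flowB_isBigO u v)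

theorem integrable_flowE (u v : ℝ) : Integrable (flowE α β u v c g τ) :=
  integrable_of_isBigO_inv_cosh h.beta_ne (h.reducedFlow u v).continuous_e (h.flowE_isBigO u v)

/-- The argument of the phase `F + iG`, rotated by `arctan T`. -/
theorem hasDerivAt_arctan_rotated (u v x : ℝ) :
    HasDerivAt (fun x => Real.arctan
      ((jetG α β u v g τ 0 x + T * jetF α β u v c τ 0 x)
        / (jetF α β u v c τ 0 x - T * jetG α β u v g τ 0 x))) (flowB α β u v c g τ x) x := by
  have hF : HasDerivAt (jetF α β u v c τ 0) (jetF α β u v c τ 1 x) x :=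
    hasDerivAt_jet α β u v 0 _ _ _ _ x
  have hG : HasDerivAt (jetG α β u v g τ 0) (jetG α β u v g τ 1 x) x :=
    hasDerivAt_jet α β u v 0 _ _ _ _ x
  have hR := (h.rotated_pos u v x).ne'
  have hN := (h.norm_sq_pos u v x).ne'
  refine (((hG.add (hF.const_mul T)).div (hF.sub (hG.const_mul T)) hR).arctan).congr_deriv ?_
  simp only [Pi.add_apply, Pi.sub_apply, Pi.div_apply]
  unfold flowB
  have hT : (1 + T ^ 2) ≠ 0 := by positivity
  generalize jetF α β u v c τ 0 x = F at *
  generalize jetG α β u v g τ 0 x = G at *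
  have h1 : 1 + ((G + T * F) / (F - T * G)) ^ 2
      = (1 + T ^ 2) * (F ^ 2 + G ^ 2) / (F - T * G) ^ 2 := by
    rw [eq_div_iff (pow_ne_zero 2 hR), div_pow, add_mul, div_mul_cancel₀ _ (pow_ne_zero 2 hR)]
    ring
  rw [h1]
  field_simp
  ring

end PhaseData

/-! ### Limits at both ends and the integral. -/

theorem tendsto_flowPrimitive {c K ρ σ : ℝ} {a b e : ℝ → ℝ} {l : Filter ℝ}
    (ha : Tendsto a l (𝓝 σ)) (hb : Tendsto b l (𝓝 0)) (he : Tendsto e l (𝓝 0)) :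
    Tendsto (fun x => flowPrimitive c K ρ (a x) (b x) (e x)) l
      (𝓝 (flowPrimitive c K ρ σ 0 0)) := by
  have hc : Continuous (fun y : ℝ × ℝ × ℝ => flowPrimitive c K ρ y.1 y.2.1 y.2.2) := by
    unfold flowPrimitive
    fun_prop
  have hl : Tendsto (fun x => (a x, b x, e x)) l (𝓝 (σ, 0, 0)) :=
    ha.prodMk_nhds (hb.prodMk_nhds he)
  have h := (hc.tendsto (σ, 0, 0)).comp hl
  simpa only [Function.comp_def] using h

namespace PhaseData

variable {α β c g τ T : ℝ} (h : PhaseData α β c g τ T)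
include h

section Limits

variable {l : Filter ℝ} {u v : ℝ}

/-- Limits of the reduced variables at an end where `F`, `G` and their derivatives, suitably
normalised, converge to `A (1, σ, σ²)`. -/
theorem tendsto_flow_of_normalised {k : ℝ → ℝ} {A B σ : ℝ} (hk : ∀ x, k x ≠ 0) (hA : A ≠ 0)
    (hF₀ : Tendsto (fun x => k x * jetF α β u v c τ 0 x) l (𝓝 A))
    (hF₁ : Tendsto (fun x => k x * jetF α β u v c τ 1 x) l (𝓝 (σ * A)))
    (hF₂ : Tendsto (fun x => k x * jetF α β u v c τ 2 x) l (𝓝 (σ * (σ * A))))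
    (hG₀ : Tendsto (fun x => k x * jetG α β u v g τ 0 x) l (𝓝 B))
    (hG₁ : Tendsto (fun x => k x * jetG α β u v g τ 1 x) l (𝓝 (σ * B)))
    (hG₂ : Tendsto (fun x => k x * jetG α β u v g τ 2 x) l (𝓝 (σ * (σ * B))))
    (hAB : A - T * B ≠ 0) :
    Tendsto (flowA α β u v c g τ) l (𝓝 σ) ∧ Tendsto (flowB α β u v c g τ) l (𝓝 0) ∧
    Tendsto (flowE α β u v c g τ) l (𝓝 0) ∧
    Tendsto (fun x => Real.arctan ((jetG α β u v g τ 0 x + T * jetF α β u v c τ 0 x)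
        / (jetF α β u v c τ 0 x - T * jetG α β u v g τ 0 x))) l
      (𝓝 (Real.arctan ((B + T * A) / (A - T * B)))) := by
  have hN : A ^ 2 + B ^ 2 ≠ 0 := by positivity
  have hD := (hF₀.pow 2).add (hG₀.pow 2)
  refine ⟨?_, ?_, ?_, ?_⟩
  · have h1 := ((hF₀.mul hF₁).add (hG₀.mul hG₁)).div hD hN
    rw [show (A * (σ * A) + B * (σ * B)) / (A ^ 2 + B ^ 2) = σ by field_simp] at h1
    refine h1.congr fun x => ?_
    have := hk x
    have := (h.norm_sq_pos u v x).ne'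
    simp only [flowA, Pi.div_apply]
    field_simp
  · have h1 := ((hF₀.mul hG₁).sub (hG₀.mul hF₁)).div hD hN
    rw [show (A * (σ * B) - B * (σ * A)) / (A ^ 2 + B ^ 2) = 0 by ring] at h1
    refine h1.congr fun x => ?_
    have := hk x
    have := (h.norm_sq_pos u v x).ne'
    simp only [flowB, Pi.div_apply]
    field_simp
  · have h1 := ((hF₀.mul hG₂).sub (hG₀.mul hF₂)).div hD hN
    rw [show (A * (σ * (σ * B)) - B * (σ * (σ * A))) / (A ^ 2 + B ^ 2) = 0 by ring] at h1
    refine h1.congr fun x => ?_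
    have := hk x
    have := (h.norm_sq_pos u v x).ne'
    simp only [flowE, Pi.div_apply]
    field_simp
  · have h1 := (hG₀.add (hF₀.const_mul T)).div (hF₀.sub (hG₀.const_mul T)) hAB
    refine ((Real.continuous_arctan.tendsto _).comp h1).congr fun x => ?_
    simp only [Function.comp, Pi.div_apply]
    rw [show k x * jetG α β u v g τ 0 x + T * (k x * jetF α β u v c τ 0 x)
        = k x * (jetG α β u v g τ 0 x + T * jetF α β u v c τ 0 x) by ring,
      show k x * jetF α β u v c τ 0 x - T * (k x * jetG α β u v g τ 0 x)
        = k x * (jetF α β u v c τ 0 x - T * jetG α β u v g τ 0 x) by ring,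
      mul_div_mul_left _ _ (hk x)]

/-- At this end `f ~ (1/2 - ig) e^X`; at the other `f ~ e^{-X}/2`, with argument 0. Rotation by the
half angle makes the two limiting phases opposite. The filter is left general so that both signs of
`β` are covered. -/
theorem tendsto_flow_pos (hl : Tendsto (fun x => β * (x + v)) l atTop) :
    Tendsto (flowA α β u v c g τ) l (𝓝 β) ∧ Tendsto (flowB α β u v c g τ) l (𝓝 0) ∧
    Tendsto (flowE α β u v c g τ) l (𝓝 0) ∧
    Tendsto (fun x => Real.arctan ((jetG α β u v g τ 0 x + T * jetF α β u v c τ 0 x)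
        / (jetF α β u v c τ 0 x - T * jetG α β u v g τ 0 x))) l (𝓝 (-Real.arctan T)) := by
  have hm := fun p q r s => tendsto_exp_neg_mul_modes α β u v p q r s hl
  have hpos : (1 / 2 - T * -g) ≠ 0 := by linarith [h.half_le]
  have hT : (-g + T * (1 / 2)) / (1 / 2 - T * -g) = -T := by
    rw [div_eq_iff hpos]
    linear_combination -h.exp_coeff_tan
  rw [← Real.arctan_neg, ← hT]
  exact h.tendsto_flow_of_normalised (fun x => (Real.exp_pos _).ne') (by norm_num)
    (hm _ _ _ _) (hm _ _ _ _) (hm _ _ _ _) (hm _ _ _ _) (hm _ _ _ _) (hm _ _ _ _) hpos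

theorem tendsto_flow_neg (hl : Tendsto (fun x => β * (x + v)) l atBot) :
    Tendsto (flowA α β u v c g τ) l (𝓝 (-β)) ∧ Tendsto (flowB α β u v c g τ) l (𝓝 0) ∧
    Tendsto (flowE α β u v c g τ) l (𝓝 0) ∧
    Tendsto (fun x => Real.arctan ((jetG α β u v g τ 0 x + T * jetF α β u v c τ 0 x)
        / (jetF α β u v c τ 0 x - T * jetG α β u v g τ 0 x))) l (𝓝 (Real.arctan T)) := by
  have hm := fun p q r s => tendsto_exp_mul_modes α β u v p q r s hl
  have hT : (0 + T * (1 / 2)) / (1 / 2 - T * 0) = T := by ring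
  have H := h.tendsto_flow_of_normalised (fun x => (Real.exp_pos _).ne') (by norm_num)
    (hm _ _ _ _) (hm _ _ _ _) (hm _ _ _ _) (hm _ _ _ _) (hm _ _ _ _) (hm _ _ _ _) (by norm_num)
  rwa [hT] at H

end Limits

/-- The integral of the density of `functionalF` along the breather. -/
theorem integral_density (u v : ℝ)
    (hi : Integrable fun x => flowDensity c (β ^ 2 - α ^ 2) (flowA α β u v c g τ x)
      (flowB α β u v c g τ x) (flowE α β u v c g τ x)) :
    ∫ x, flowDensity c (β ^ 2 - α ^ 2) (flowA α β u v c g τ x)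
      (flowB α β u v c g τ x) (flowE α β u v c g τ x) =
    2 * flowPrimitive c (β ^ 2 - α ^ 2) (α ^ 2 * β ^ 2) |β| 0 0
      + 2 * c ^ 5 * Real.arctan (2 * c * |β| / (α ^ 2 + β ^ 2 - c ^ 2)) := by
  have hT := (sq_lt_one_iff_abs_lt_one T).1 h.tan_sq_lt
  have harc : 2 * Real.arctan T = Real.arctan (2 * c * β / (α ^ 2 + β ^ 2 - c ^ 2)) := by
    rw [Real.two_mul_arctan (abs_lt.1 hT).1 (abs_lt.1 hT).2]
    congr 1
    have h1 : 1 - T ^ 2 ≠ 0 := by linarith [h.tan_sq_lt]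
    rw [div_eq_div_iff h1 h.delta_pos.ne']
    linear_combination -2 * h.tan_eq
  have hd : ∀ x, HasDerivAt (fun x => flowPrimitive c (β ^ 2 - α ^ 2) (α ^ 2 * β ^ 2)
      (flowA α β u v c g τ x) (flowB α β u v c g τ x) (flowE α β u v c g τ x)
      - 2 * c ^ 5 * Real.arctan ((jetG α β u v g τ 0 x + T * jetF α β u v c τ 0 x)
        / (jetF α β u v c τ 0 x - T * jetG α β u v g τ 0 x)))
      (flowDensity c (β ^ 2 - α ^ 2) (flowA α β u v c g τ x)
        (flowB α β u v c g τ x) (flowE α β u v c g τ x)) x := fun x =>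
    (((h.reducedFlow u v).hasDerivAt_primitive x).sub
      ((h.hasDerivAt_arctan_rotated u v x).const_mul (2 * c ^ 5))).congr_deriv (by ring)
  -- With `b = e = 0` only odd powers of `a` survive, so the two boundary values add instead of
  -- cancelling.
  have hodd : flowPrimitive c (β ^ 2 - α ^ 2) (α ^ 2 * β ^ 2) (-β) 0 0
      = -flowPrimitive c (β ^ 2 - α ^ 2) (α ^ 2 * β ^ 2) β 0 0 := by
    unfold flowPrimitive
    ring
  have lim_pos := fun {l : Filter ℝ} (hl : Tendsto (fun x => β * (x + v)) l atTop) =>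
    have H := h.tendsto_flow_pos (u := u) hl
    (tendsto_flowPrimitive (c := c) (K := β ^ 2 - α ^ 2) (ρ := α ^ 2 * β ^ 2) H.1 H.2.1
      H.2.2.1).sub (H.2.2.2.const_mul (2 * c ^ 5))
  have lim_neg := fun {l : Filter ℝ} (hl : Tendsto (fun x => β * (x + v)) l atBot) =>
    have H := h.tendsto_flow_neg (u := u) hl
    (tendsto_flowPrimitive (c := c) (K := β ^ 2 - α ^ 2) (ρ := α ^ 2 * β ^ 2) H.1 H.2.1
      H.2.2.1).sub (H.2.2.2.const_mul (2 * c ^ 5))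
  have htop : Tendsto (fun x : ℝ => x + v) atTop atTop := tendsto_atTop_add_const_right _ _ tendsto_id
  have hbot : Tendsto (fun x : ℝ => x + v) atBot atBot := tendsto_atBot_add_const_right _ _ tendsto_id
  -- For `β < 0` the two ends exchange roles; oddness of the boundary polynomial and of `arctan`
  -- turns `β` into `|β|`.
  rcases lt_or_gt_of_ne h.beta_ne with hβ | hβ
  · rw [integral_of_hasDerivAt_of_tendsto hd hi (lim_pos (hbot.const_mul_atBot_of_neg hβ))
      (lim_neg (htop.const_mul_atTop_of_neg hβ)), abs_of_neg hβ, hodd,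
      show 2 * c * -β / (α ^ 2 + β ^ 2 - c ^ 2) = -(2 * c * β / (α ^ 2 + β ^ 2 - c ^ 2)) by ring,
      Real.arctan_neg, ← harc]
    ring
  · rw [integral_of_hasDerivAt_of_tendsto hd hi (lim_neg (hbot.const_mul_atBot hβ))
      (lim_pos (htop.const_mul_atTop hβ)), abs_of_pos hβ, hodd, ← harc]
    ring

end PhaseData

/-! ### Identification with the breather and conclusion. -/

theorem F_eq_jet (α β μ x1 x2 t : ℝ) : F α β μ x1 x2 t =
    jetF α β (delta α β * t + x1) (gam α β * t + x2) (√2 * μ)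
      (β / (α * √(α ^ 2 + β ^ 2) * √(Delta α β μ))) 0 := by
  funext x
  simp only [F, y1, y2, jetF, jet, modes, Real.cosh_eq, add_assoc]
  ring

theorem G_eq_jet {α : ℝ} (hα : α ≠ 0) (β μ x1 x2 t : ℝ) : G α β μ x1 x2 t =
    jetG α β (delta α β * t + x1) (gam α β * t + x2) (√2 * μ * β / Delta α β μ)
      (β / (α * √(α ^ 2 + β ^ 2) * √(Delta α β μ))) 0 := by
  funext x
  have hs : √(α ^ 2 + β ^ 2) ^ 2 = α ^ 2 + β ^ 2 := Real.sq_sqrt (by positivity)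
  have hs0 : √(α ^ 2 + β ^ 2) ≠ 0 := by positivity
  have hτ : β * √(α ^ 2 + β ^ 2) / (α * √(Delta α β μ))
      = (α ^ 2 + β ^ 2) * (β / (α * √(α ^ 2 + β ^ 2) * √(Delta α β μ))) := by
    rw [mul_div_assoc', mul_right_comm α,
      show (α ^ 2 + β ^ 2) * β = β * √(α ^ 2 + β ^ 2) * √(α ^ 2 + β ^ 2) by
        linear_combination -β * hs,
      mul_div_mul_right _ _ hs0]
  simp only [G, y1, y2, jetG, jet, modes, Real.cosh_add_sinh, add_assoc, hτ]
  ring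

theorem contDiff_breather {α β μ x1 x2 t : ℝ}
    (hpos : ∀ x, 0 < F α β μ x1 x2 t x ^ 2 + G α β μ x1 x2 t x ^ 2) :
    ContDiff ℝ (⊤ : ℕ∞) (breather α β μ x1 x2 t) := by
  have hF : ContDiff ℝ (⊤ : ℕ∞) (F α β μ x1 x2 t) := by
    unfold F y1 y2
    fun_prop
  have hG : ContDiff ℝ (⊤ : ℕ∞) (G α β μ x1 x2 t) := by
    unfold G y1 y2
    fun_prop
  have hF' : ContDiff ℝ (⊤ : ℕ∞) (deriv (F α β μ x1 x2 t)) := (contDiff_infty_iff_deriv.1 hF).2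
  have hG' : ContDiff ℝ (⊤ : ℕ∞) (deriv (G α β μ x1 x2 t)) := (contDiff_infty_iff_deriv.1 hG).2
  exact contDiff_const.mul (((hG'.mul hF).sub (hG.mul hF')).div ((hF.pow 2).add (hG.pow 2))
    fun x => (hpos x).ne')

end Gardner

end

theorem lemma4p2 (α β μ x1 x2 t : ℝ) (hα : α ≠ 0) (hβ : β ≠ 0) (hμ : μ ≠ 0)
    (hΔ : 0 < Gardner.Delta α β μ) :
    (∀ x, 0 < Gardner.F α β μ x1 x2 t x ^ 2 + Gardner.G α β μ x1 x2 t x ^ 2) ∧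
    ContDiff ℝ (⊤ : ℕ∞) (Gardner.breather α β μ x1 x2 t) ∧
    Gardner.FunctionalFConverges (Gardner.breather α β μ x1 x2) t ∧
    Gardner.functionalF μ (Gardner.breather α β μ x1 x2) t =
      4 / 15 * (3 * |β| * (β ^ 4 - 10 * β ^ 2 * α ^ 2 + 5 * α ^ 4)
          - 10 * μ ^ 2 * |β| * (β ^ 2 - 3 * α ^ 2 - 6 * μ ^ 2))
        + 8 * √2 * μ ^ 5 * Real.arctan (2 * √2 * μ * |β| / Gardner.Delta α β μ) := by
  have hs : √2 ^ 2 = (2 : ℝ) := Real.sq_sqrt (by norm_num)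
  have hs4 : √2 ^ 4 = (4 : ℝ) := by linear_combination (√2 ^ 2 + 2) * hs
  have hs5 : √2 ^ 5 = 4 * √2 := by rw [pow_succ, hs4]
  have hc : √2 * μ ≠ 0 := mul_ne_zero (by positivity) hμ
  have hD : α ^ 2 + β ^ 2 - (√2 * μ) ^ 2 = Gardner.Delta α β μ := by
    rw [mul_pow, hs, Gardner.Delta]
  obtain ⟨T, h⟩ := Gardner.exists_phaseData hα hβ hc (hD ▸ hΔ)
  have hF := Gardner.F_eq_jet α β μ x1 x2 t
  have hG := Gardner.G_eq_jet hα β μ x1 x2 t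
  rw [hD] at h
  -- All dependence on `t`, `x1`, `x2` sits in `u` and `v`, which are arbitrary reals in the results
  -- applied below.
  set u := Gardner.delta α β * t + x1
  set v := Gardner.gam α β * t + x2
  set g := √2 * μ * β / Gardner.Delta α β μ
  set τ := β / (α * √(α ^ 2 + β ^ 2) * √(Gardner.Delta α β μ))
  have hpos : ∀ x, 0 < Gardner.F α β μ x1 x2 t x ^ 2 + Gardner.G α β μ x1 x2 t x ^ 2 := by
    rw [hF, hG]
    exact h.norm_sq_pos u v
  have hw : Gardner.breather α β μ x1 x2 t
      = fun x => 2 * √2 * Gardner.flowB α β u v (√2 * μ) g τ x := by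
    funext x
    unfold Gardner.breather
    rw [hF, hG, show deriv (Gardner.jetF α β u v (√2 * μ) τ 0) x
        = Gardner.jetF α β u v (√2 * μ) τ 1 x from (Gardner.hasDerivAt_jet α β u v 0 _ _ _ _ x).deriv,
      show deriv (Gardner.jetG α β u v g τ 0) x = Gardner.jetG α β u v g τ 1 x from
        (Gardner.hasDerivAt_jet α β u v 0 _ _ _ _ x).deriv, Gardner.flowB]
    ring
  obtain ⟨M, hMa, hMb, hMe⟩ := h.exists_flow_bound u v
  have hconv := (h.reducedFlow u v).functionalFConverges hw (h.integrable_flowB u v)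
    (h.integrable_flowE u v) hMa hMb hMe
  obtain ⟨hi, hval⟩ := (h.reducedFlow u v).functionalF_eq rfl hw hconv
  refine ⟨hpos, Gardner.contDiff_breather hpos, hconv, ?_⟩
  rw [hval, h.integral_density u v hi, hD, ← mul_assoc 2 (√2) μ]
  simp only [Gardner.flowPrimitive, mul_pow, hs, hs4, hs5]
  have hb : |β| ^ 2 = β ^ 2 := sq_abs β
  linear_combination (64 / 5 * |β| ^ 3 + 64 / 5 * |β| * β ^ 2 + 16 / 3 * μ ^ 2 * |β|
    - 16 * (β ^ 2 - α ^ 2) * |β|) * hb
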